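/- For positive integers $p,q$ let $G(p,q)$ be the subgroup of $SO(3)$ generated by the rotation $A$ about the $x$-axis by the angle $2\pi/p$ and the rotation $B$ about the $z$-axis by the angle $2\pi/q$. Let $\mathbb{Z}_p=\langle\alpha:\alpha^p\rangle$ be the cyclic group of order $p$, and consider the dihedral groups $D_p=\langle\alpha,\gamma:\alpha^p,\gamma^2,\gamma\alpha\gamma\alpha\rangle$ of order $2p$ and $D_q=\langle\beta,\mu:\beta^q,\mu^2,\mu\beta\mu\beta\rangle$ of order $2q$. (1) If $p\ge 4$ is even and $q\ge 3$ is odd, then $G(p,q)$ is isomorphic to the amalgamated free product $\mathbb{Z}_p *_{\mathbb{Z}_2} D_q$, where the element $\alpha^{p/2}\in\mathbb{Z}_p$ of order two is identified with $\mu\in D_q$. (2) If $p\ge 4$ is even and $q=2s$ with $s\ge 3$ odd, then $G(p,q)$ is isomorphic to the amalgamated free product $D_p *_{D_2} D_q$, where the subgroups $\langle\alpha^{p/2},\gamma\rangle\cong D_2$ of $D_p$ and $\langle\mu,\beta^{q/2}\rangle\cong D_2$ of $D_q$ are identified by $\gamma\leftrightarrow\beta^{q/2}$ and $\alpha^{p/2}\leftrightarrow\mu$.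 In both cases the isomorphism can be chosen so that $\alpha\mapsto A$ and $\beta\mapsto B$. -/

import Mathlib

open Real

namespace RotationGroup

/-- The group `SO(3)` of rotations of Euclidean 3-space, as real matrices. -/
abbrev SO3 : Type := Matrix.specialOrthogonalGroup (Fin 3) ℝ

/-- The rotation about the `x`-axis by the angle `θ`. -/
noncomputable def rotX (θ : ℝ) : SO3 :=
  ⟨!![1, 0, 0; 0, cos θ, -sin θ; 0, sin θ, cos θ], by
    have h := sin_sq_add_cos_sq θ
    rw [Matrix.mem_specialOrthogonalGroup_iff, Matrix.mem_orthogonalGroup_iff]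
    constructor
    · ext i j
      fin_cases i <;> fin_cases j <;>
        simp [Matrix.mul_apply, Fin.sum_univ_three] <;> linarith
    · simp [Matrix.det_fin_three]
      linarith⟩

/-- The rotation about the `z`-axis by the angle `θ`. -/
noncomputable def rotZ (θ : ℝ) : SO3 :=
  ⟨!![cos θ, -sin θ, 0; sin θ, cos θ, 0; 0, 0, 1], by
    have h := sin_sq_add_cos_sq θ
    rw [Matrix.mem_specialOrthogonalGroup_iff, Matrix.mem_orthogonalGroup_iff]
    constructor
    · ext i j
      fin_cases i <;> fin_cases j <;>
        simp [Matrix.mul_apply, Fin.sum_univ_three] <;> linarith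
    · simp [Matrix.det_fin_three]
      linarith⟩

/-- `A`, the rotation about the `x`-axis by `2π/p`. -/
noncomputable def rotA (p : ℕ) : SO3 := rotX (2 * π / p)

/-- `B`, the rotation about the `z`-axis by `2π/q`. -/
noncomputable def rotB (q : ℕ) : SO3 := rotZ (2 * π / q)

/-- `G(p,q)`, the subgroup of `SO(3)` generated by `A` and `B`. -/
noncomputable def G (p q : ℕ) : Subgroup SO3 := Subgroup.closure {rotA p, rotB q}

section Amalgam

universe u v

/-- The two factors of an amalgamated product, as a family indexed by `Bool`. -/
def Factor (K L : Type u) : Bool → Type u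
  | false => K
  | true => L

instance (K L : Type u) [Group K] [Group L] : (i : Bool) → Group (Factor K L i)
  | false => inferInstanceAs (Group K)
  | true => inferInstanceAs (Group L)

/-- The two homomorphisms from the amalgamated group `H` to the factors, as a family. -/
def factorHom {K L : Type u} {H : Type v} [Group K] [Group L] [Group H]
    (φ : H →* K) (ψ : H →* L) : (i : Bool) → H →* Factor K L i
  | false => φ
  | true => ψ

/-- The amalgamated free product `K *_H L`: the pushout of `φ : H →* K` and `ψ : H →* L` in the
category of groups, in which `φ h` is identified with `ψ h` for each `h` in `H`. -/
abbrev Amalgam {K L : Type u} {H : Type v} [Group K] [Group L] [Group H]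
    (φ : H →* K) (ψ : H →* L) : Type (max u v) :=
  Monoid.PushoutI (factorHom φ ψ)

/-- The canonical map from the left factor to the amalgamated free product. -/
def Amalgam.inl {K L : Type u} {H : Type v} [Group K] [Group L] [Group H]
    (φ : H →* K) (ψ : H →* L) : K →* Amalgam φ ψ :=
  Monoid.PushoutI.of (φ := factorHom φ ψ) false

/-- The canonical map from the right factor to the amalgamated free product. -/
def Amalgam.inr {K L : Type u} {H : Type v} [Group K] [Group L] [Group H]
    (φ : H →* K) (ψ : H →* L) : L →* Amalgam φ ψ :=
  Monoid.PushoutI.of (φ := factorHom φ ψ) true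

end Amalgam

/-- The cyclic group `ℤ_n`, written multiplicatively. -/
abbrev Cyc (n : ℕ) : Type := Multiplicative (ZMod n)

/-- The standard generator of the cyclic group `ℤ_n`. -/
def Cyc.gen (n : ℕ) : Cyc n := Multiplicative.ofAdd 1

/-- The generator `ρ` of order `n` in the dihedral group
`D_n = ⟨ρ, τ : ρ^n, τ^2, τρτρ⟩` of order `2n`. -/
def rho (n : ℕ) : DihedralGroup n := DihedralGroup.r 1

/-- The generator `τ` of order two in the dihedral group
`D_n = ⟨ρ, τ : ρ^n, τ^2, τρτρ⟩` of order `2n`. -/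
def tau (n : ℕ) : DihedralGroup n := DihedralGroup.sr 0

end RotationGroup

/-! The proof is a ping-pong argument on the sizes of coordinates for a valuation lying over 2.
Choose a valuation `v` on `ℂ` with `v 2 < 1` and restrict it to `ℝ`; a large value then means a
large denominator at 2. For ζ = exp(iθ) of finite order, 2ζ cos θ = ζ² + 1 and 2iζ sin θ = ζ² - 1.
Unless ζ² = ±1, the number ζ² - 1 is larger than 2 (`val_two_lt_sub_one`), so cos θ and sin θ have
the same valuation, and it exceeds 1.

Such a rotation about the z-axis takes a vector whose first two coordinates have different
valuations, the third being no larger than their maximum, to one where these two agree and dominate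
the third, and it strictly increases the size (`isZStep_rotZ`). A rotation about the x-axis leads
back without decreasing the size (`isXStep_rotX`), quarter turns included. A quarter turn about the
z-axis would break the scheme; it is absent because q is odd or twice an odd number. Half turns
about the axes only change signs, and the amalgamated subgroups consist of these and the identity.

Apply a normal form in the amalgam to the first basis vector, which x-rotations fix. If the word
acts trivially, the size stays 1, so no z-letter occurs and the word lies in the left factor, which
acts faithfully (`injective_of_pingPong`). The half turns are powers of A and B, so the image is
exactly G(p,q). -/

namespace RotationGroup

/-! ### Roots of unity under a valuation over 2. -/

section DyadicValuation

/-- There is a valuation on `ℂ` for which `2` has value less than one. -/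
theorem exists_valuation_two_lt_one :
    ∃ (Γ : Type) (_ : LinearOrderedCommGroupWithZero Γ) (v : Valuation ℂ Γ), v 2 < 1 := by
  -- The prime subring is ℤ, where 2 is not a unit; a valuation ring of `ℂ` can then be found in
  -- which 2 is a nonunit.
  have hI : (Ideal.span {(2 : (⊥ : Subring ℂ))}) ≠ ⊤ := by
    rw [Ne, Ideal.span_singleton_eq_top]
    intro h
    obtain ⟨⟨b, hb⟩, hb'⟩ := h.exists_right_inv
    obtain ⟨n, rfl⟩ := Subring.mem_bot.mp hb
    have h1 : (2 : ℂ) * n = 1 := congrArg Subtype.val hb'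
    have h2 : (2 : ℤ) * n = 1 := by exact_mod_cast h1
    omega
  obtain ⟨V, -, hV⟩ := Ideal.image_subset_nonunits_valuationSubring _ hI
  refine ⟨V.ValueGroup, inferInstance, V.valuation, ?_⟩
  exact hV ⟨2, Ideal.mem_span_singleton_self _, rfl⟩

variable {Γ : Type*} [LinearOrderedCommGroupWithZero Γ] {v : Valuation ℂ Γ}

theorem val_eq_one_of_pow_eq_one {z : ℂ} {n : ℕ} (hn : n ≠ 0) (h : z ^ n = 1) : v z = 1 := by
  have : v z ^ n = 1 := by rw [← map_pow, h, map_one]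
  exact (pow_eq_one_iff_of_nonneg zero_le hn).mp this

theorem val_I : v Complex.I = 1 :=
  val_eq_one_of_pow_eq_one (n := 4) (by norm_num) Complex.I_pow_four

theorem val_natCast_le_one (n : ℕ) : v n ≤ 1 := by
  induction n with
  | zero => simp
  | succ n ih =>
    push_cast
    exact v.map_add_le ih (by simp)

theorem val_odd (hv : v 2 < 1) {m : ℕ} (hm : Odd m) : v m = 1 := by
  obtain ⟨k, rfl⟩ := hm
  push_cast
  rw [add_comm]
  apply v.map_one_add_of_lt
  rw [map_mul]
  exact mul_lt_one_of_lt_of_le hv (val_natCast_le_one k)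

/-- The cofactor 1 + z + ... + z^(k-1) is integral. -/
theorem val_pow_sub_one_le {z : ℂ} (hz : v z = 1) (k : ℕ) : v (z ^ k - 1) ≤ v (z - 1) := by
  rw [← mul_geom_sum z k, map_mul]
  apply mul_le_of_le_one_right'
  exact v.map_sum_le fun i _ => by simp [hz]

/-- If z were congruent to 1 modulo the maximal ideal, then 0 = 1 + z + ... + z^(m-1) would be
congruent to m, which is a unit because m is odd. -/
theorem val_sub_one_of_odd_order (hv : v 2 < 1) {z : ℂ} {m : ℕ} (hm : Odd m) (h : z ^ m = 1)
    (h1 : z ≠ 1) : v (z - 1) = 1 := by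
  have hz : v z = 1 := val_eq_one_of_pow_eq_one hm.pos.ne' h
  refine le_antisymm (v.map_sub_le hz.le (by simp)) (not_lt.mp fun hlt => ?_)
  have h0 : ∑ i ∈ Finset.range m, z ^ i = 0 := by
    have := mul_geom_sum z m
    rw [h, sub_self, mul_eq_zero] at this
    exact this.resolve_left (sub_ne_zero.mpr h1)
  have h2 : (m : ℂ) = -∑ i ∈ Finset.range m, (z ^ i - 1) := by
    rw [Finset.sum_sub_distrib, h0]; simp
  have h3 : v (m : ℂ) < 1 := by
    rw [h2, Valuation.map_neg]
    exact v.map_sum_lt one_ne_zero fun i _ => (val_pow_sub_one_le hz i).trans_lt hlt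
  exact h3.ne (val_odd hv hm)

theorem val_add_one_of_val_two_lt {z : ℂ} (h : v 2 < v (z - 1)) : v (z + 1) = v (z - 1) := by
  rw [show z + 1 = (z - 1) + 2 by ring]
  exact v.map_add_eq_of_lt_left h

theorem val_two_pos : 0 < v 2 := by
  rw [Valuation.pos_iff]; norm_num

/-- A root of unity congruent to `1` modulo `2` is `±1`. -/
theorem val_two_lt_sub_one (hv : v 2 < 1) {z : ℂ} {n : ℕ} (hn : n ≠ 0) (h : z ^ n = 1)
    (h1 : z ^ 2 ≠ 1) : v 2 < v (z - 1) := by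
  by_contra! hle
  have hz : v z = 1 := val_eq_one_of_pow_eq_one hn h
  have key : ∀ k : ℕ, v (z ^ k - 1) ≤ v 2 := fun k => (val_pow_sub_one_le hz k).trans hle
  -- No even power of z is -1: if z^(2j) = -1, then (z^j - 1)² = -2z^j has valuation `v 2`, while
  -- `key` bounds it by the strictly smaller `v 2 * v 2`.
  have hsq : ∀ k : ℕ, z ^ k ≠ -1 ∨ ∀ j, k ≠ 2 * j := by
    intro k
    by_contra! hk
    obtain ⟨hk, j, rfl⟩ := hk
    have e : (z ^ j - 1) ^ 2 = -(2 * z ^ j) := by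
      have : (z ^ j) ^ 2 = -1 := by rw [← pow_mul, mul_comm, hk]
      linear_combination this
    have e2 : v (z ^ j - 1) ^ 2 = v 2 := by
      rw [← map_pow, e, Valuation.map_neg, map_mul, map_pow, hz, one_pow, mul_one]
    have : v 2 ≤ v 2 * v 2 := by
      conv_lhs => rw [← e2]
      rw [sq]
      exact mul_le_mul' (key j) (key j)
    have h3 : v 2 * v 2 < v 2 * 1 := by
      exact (mul_lt_mul_iff_right₀ val_two_pos).mpr hv
    rw [mul_one] at h3
    exact absurd this (not_le.mpr h3)
  obtain ⟨k, m, hm, rfl⟩ := Nat.exists_eq_two_pow_mul_odd hn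
  -- This power has odd order, so if it were nontrivial its distance to 1 would be 1, against `key`.
  have h2k : z ^ (2 ^ k) = 1 := by
    by_contra hne
    have := val_sub_one_of_odd_order hv hm (by rw [← pow_mul, h]) hne
    exact absurd ((key (2 ^ k)).trans_lt hv) (by rw [this]; exact lt_irrefl _)
  -- Square roots are taken repeatedly; `hsq` excludes the root -1 as long as the exponent is even,
  -- so the descent stops at z² = 1.
  have hdesc : ∀ k, z ^ (2 ^ (k + 1)) = 1 → z ^ 2 = 1 := by
    intro k
    induction k with
    | zero => intro h; simpa using h
    | succ k ih =>
      intro hk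
      rw [pow_succ 2 (k + 1), pow_mul, sq, mul_self_eq_one_iff] at hk
      rcases hk with hk | hk
      · exact ih hk
      · exact ((hsq _).resolve_left (not_not.mpr hk) (2 ^ k) (pow_succ' 2 k)).elim
  cases k with
  | zero => exact h1 (by rw [show z = 1 by simpa using h2k]; simp)
  | succ k => exact h1 (hdesc k h2k)

end DyadicValuation

/-! ### Valuations of sines and cosines of rational angles. -/

section Trigonometry

variable {Γ : Type*} [LinearOrderedCommGroupWithZero Γ] {v : Valuation ℂ Γ}

theorem exp_mul_two_cos (θ : ℝ) :
    Complex.exp (θ * Complex.I) * (2 * (cos θ : ℝ)) = Complex.exp (θ * Complex.I) ^ 2 + 1 := by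
  rw [Complex.exp_mul_I, ← Complex.ofReal_cos, ← Complex.ofReal_sin]
  have h : ((sin θ : ℝ) : ℂ) ^ 2 + ((cos θ : ℝ) : ℂ) ^ 2 = 1 := by
    exact_mod_cast sin_sq_add_cos_sq θ
  linear_combination (-((sin θ : ℝ) : ℂ) ^ 2) * Complex.I_sq + h

theorem exp_mul_two_sin (θ : ℝ) :
    Complex.exp (θ * Complex.I) * (Complex.I * (2 * (sin θ : ℝ))) =
      Complex.exp (θ * Complex.I) ^ 2 - 1 := by
  rw [Complex.exp_mul_I, ← Complex.ofReal_cos, ← Complex.ofReal_sin]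
  have h : ((sin θ : ℝ) : ℂ) ^ 2 + ((cos θ : ℝ) : ℂ) ^ 2 = 1 := by
    exact_mod_cast sin_sq_add_cos_sq θ
  linear_combination (((sin θ : ℝ) : ℂ) ^ 2) * Complex.I_sq - h

theorem val_two_mul_val_cos {θ : ℝ} (h : v (Complex.exp (θ * Complex.I)) = 1) :
    v 2 * v (cos θ : ℝ) = v (Complex.exp (θ * Complex.I) ^ 2 + 1) := by
  rw [← exp_mul_two_cos, map_mul, map_mul, h, one_mul]

theorem val_two_mul_val_sin {θ : ℝ} (h : v (Complex.exp (θ * Complex.I)) = 1) :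
    v 2 * v (sin θ : ℝ) = v (Complex.exp (θ * Complex.I) ^ 2 - 1) := by
  rw [← exp_mul_two_sin, map_mul, map_mul, map_mul, h, val_I, one_mul, one_mul]

/-- The numbers ζ² + 1 and ζ² - 1 differ by 2, which is too small to affect their valuation. -/
theorem val_cos_sin_of_val_two_lt {θ : ℝ} (h : v (Complex.exp (θ * Complex.I)) = 1)
    (h2 : v 2 < v (Complex.exp (θ * Complex.I) ^ 2 - 1)) :
    v (cos θ : ℝ) = v (sin θ : ℝ) ∧ 1 < v (sin θ : ℝ) := by
  have hc := val_two_mul_val_cos h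
  have hs := val_two_mul_val_sin h
  rw [val_add_one_of_val_two_lt h2, ← hs] at hc
  rw [← hs] at h2
  refine ⟨mul_left_cancel₀ val_two_pos.ne' hc, ?_⟩
  refine (mul_lt_mul_iff_right₀ (val_two_pos (v := v))).mp ?_
  rwa [mul_one]

theorem val_cos_sin_of_odd (hv : v 2 < 1) {θ : ℝ} {m : ℕ} (hm : Odd m)
    (h : (Complex.exp (θ * Complex.I) ^ 2) ^ m = 1) (h1 : Complex.exp (θ * Complex.I) ^ 2 ≠ 1) :
    v (cos θ : ℝ) = v (sin θ : ℝ) ∧ 1 < v (sin θ : ℝ) := by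
  refine val_cos_sin_of_val_two_lt ?_ ?_
  · exact val_eq_one_of_pow_eq_one (mul_ne_zero two_ne_zero hm.pos.ne') (by rw [pow_mul, h])
  · rwa [val_sub_one_of_odd_order hv hm h h1]

theorem val_cos_sin_of_pow_eq_one (hv : v 2 < 1) {θ : ℝ} {n : ℕ} (hn : n ≠ 0)
    (h : Complex.exp (θ * Complex.I) ^ n = 1) (h1 : Complex.exp (θ * Complex.I) ^ 2 ≠ 1) :
    (cos θ = 0 ∧ v (sin θ : ℝ) = 1) ∨ (v (cos θ : ℝ) = v (sin θ : ℝ) ∧ 1 < v (sin θ : ℝ)) := by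
  have hz : v (Complex.exp (θ * Complex.I)) = 1 := val_eq_one_of_pow_eq_one hn h
  -- As ζ² ≠ 1, the first case is ζ² = -1, a quarter turn.
  by_cases h4 : (Complex.exp (θ * Complex.I) ^ 2) ^ 2 = 1
  · left
    have h5 := (sq_eq_one_iff.mp h4).resolve_left h1
    constructor
    · have := exp_mul_two_cos θ
      rw [h5, neg_add_cancel] at this
      simpa [Complex.exp_ne_zero, -Complex.ofReal_cos] using this
    · have := val_two_mul_val_sin hz
      rw [h5, show (-1 - 1 : ℂ) = -2 by norm_num, Valuation.map_neg] at this
      exact (mul_eq_left₀ val_two_pos.ne').mp this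
  · right
    exact val_cos_sin_of_val_two_lt hz (val_two_lt_sub_one hv hn
      (by rw [← pow_mul, mul_comm 2, pow_mul, h, one_pow]) h4)

theorem exp_angle_pow {θ : ℝ} {n k : ℤ} {N : ℕ} (hn : n ≠ 0) (h : n ∣ k * N)
    (hθ : θ = k * (2 * π / n)) : Complex.exp (θ * Complex.I) ^ N = 1 := by
  obtain ⟨c, hc⟩ := h
  rw [← Complex.exp_nat_mul, Complex.exp_eq_one_iff]
  refine ⟨c, ?_⟩
  have hc' : (k : ℂ) * N = n * c := by exact_mod_cast hc
  have hn' : (n : ℂ) ≠ 0 := by exact_mod_cast hn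
  rw [hθ]
  push_cast
  field_simp
  linear_combination hc'

theorem dvd_of_exp_angle_pow {θ : ℝ} {n k : ℤ} {N : ℕ} (hn : n ≠ 0)
    (hθ : θ = k * (2 * π / n)) (h : Complex.exp (θ * Complex.I) ^ N = 1) : n ∣ k * N := by
  rw [← Complex.exp_nat_mul, Complex.exp_eq_one_iff] at h
  obtain ⟨c, hc⟩ := h
  refine ⟨c, ?_⟩
  have hn' : (n : ℂ) ≠ 0 := by exact_mod_cast hn
  have hpi : (π : ℂ) ≠ 0 := by exact_mod_cast pi_ne_zero
  rw [hθ] at hc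
  push_cast at hc
  field_simp at hc
  have : (k : ℂ) * N = n * c := by linear_combination hc
  exact_mod_cast this

end Trigonometry

/-! ### Ping-pong regions and the action of rotations on them. -/

section PingPong

variable {Γ : Type*} [LinearOrderedCommGroupWithZero Γ] (w : Valuation ℝ Γ)

/-- The larger of the valuations of the first two coordinates. -/
def planarSize (x : Fin 3 → ℝ) : Γ := max (w (x 0)) (w (x 1))

/-- The ping-pong region reached after a nontrivial rotation about the `z`-axis. -/
def IsBalanced (x : Fin 3 → ℝ) : Prop := w (x 0) = w (x 1) ∧ w (x 2) < w (x 1)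

/-- The ping-pong region reached after a nontrivial rotation about the `x`-axis. -/
def IsUnbalanced (x : Fin 3 → ℝ) : Prop := w (x 0) ≠ w (x 1) ∧ w (x 2) ≤ planarSize w x

/-- A rotation which preserves the valuation of every coordinate of every vector. -/
def PreservesVal (g : SO3) : Prop := ∀ x i, w ((g.1.mulVec x) i) = w (x i)

/-- The first basis vector. -/
def e₁ : Fin 3 → ℝ := ![1, 0, 0]

/-- The ping-pong condition on rotations about the `x`-axis. -/
def IsXStep (g : SO3) : Prop :=
  (∀ i, w (g.1.mulVec e₁ i) = w (e₁ i)) ∧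
    ∀ x, IsBalanced w x → IsUnbalanced w (g.1.mulVec x) ∧
      planarSize w x ≤ planarSize w (g.1.mulVec x)

/-- The ping-pong condition on rotations about the `z`-axis. -/
def IsZStep (g : SO3) : Prop :=
  ∀ x, IsUnbalanced w x → IsBalanced w (g.1.mulVec x) ∧
    planarSize w x < planarSize w (g.1.mulVec x)

variable {w}

theorem planarSize_congr {x y : Fin 3 → ℝ} (h : ∀ i, w (x i) = w (y i)) :
    planarSize w x = planarSize w y := by
  simp only [planarSize, h]

theorem isBalanced_congr {x y : Fin 3 → ℝ} (h : ∀ i, w (x i) = w (y i)) :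
    IsBalanced w x ↔ IsBalanced w y := by
  simp only [IsBalanced, h]

theorem isUnbalanced_congr {x y : Fin 3 → ℝ} (h : ∀ i, w (x i) = w (y i)) :
    IsUnbalanced w x ↔ IsUnbalanced w y := by
  simp only [IsUnbalanced, h, planarSize_congr h]

theorem mulVec_coe_mul (g h : SO3) (x : Fin 3 → ℝ) :
    (g * h).1.mulVec x = g.1.mulVec (h.1.mulVec x) :=
  (Matrix.mulVec_mulVec x g.1 h.1).symm

theorem PreservesVal.mul {g h : SO3} (hg : PreservesVal w g) (hh : PreservesVal w h) :
    PreservesVal w (g * h) := fun x i => by rw [mulVec_coe_mul, hg, hh]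

theorem preservesVal_one : PreservesVal w 1 := fun x i => by
  rw [show (1 : SO3).1 = 1 from rfl, Matrix.one_mulVec]

theorem PreservesVal.mul_isXStep {g h : SO3} (hg : PreservesVal w g) (hh : IsXStep w h) :
    IsXStep w (g * h) := by
  refine ⟨fun i => by rw [mulVec_coe_mul, hg, hh.1], fun x hx => ?_⟩
  rw [mulVec_coe_mul, isUnbalanced_congr (hg _), planarSize_congr (hg _)]
  exact hh.2 x hx

theorem PreservesVal.mul_isZStep {g h : SO3} (hg : PreservesVal w g) (hh : IsZStep w h) :
    IsZStep w (g * h) := by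
  intro x hx
  rw [mulVec_coe_mul, isBalanced_congr (hg _), planarSize_congr (hg _)]
  exact hh x hx

theorem planarSize_e₁ : planarSize w e₁ = 1 := by simp [planarSize, e₁]

theorem isUnbalanced_e₁ : IsUnbalanced w e₁ := by simp [IsUnbalanced, planarSize, e₁]

theorem rotX_mulVec (θ : ℝ) (x : Fin 3 → ℝ) :
    (rotX θ).1.mulVec x = ![x 0, cos θ * x 1 - sin θ * x 2, sin θ * x 1 + cos θ * x 2] := by
  ext i
  fin_cases i <;> simp [rotX, Matrix.mulVec, dotProduct, Fin.sum_univ_three]; ring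

theorem rotZ_mulVec (θ : ℝ) (x : Fin 3 → ℝ) :
    (rotZ θ).1.mulVec x = ![cos θ * x 0 - sin θ * x 1, sin θ * x 0 + cos θ * x 1, x 2] := by
  ext i
  fin_cases i <;> simp [rotZ, Matrix.mulVec, dotProduct, Fin.sum_univ_three]; ring

theorem preservesVal_rotX_pi : PreservesVal w (rotX π) := fun x i => by
  rw [rotX_mulVec]; fin_cases i <;> simp [Valuation.map_neg]

theorem preservesVal_rotZ_pi : PreservesVal w (rotZ π) := fun x i => by
  rw [rotZ_mulVec]; fin_cases i <;> simp [Valuation.map_neg]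

/-- Mixing two numbers of distinct valuations by coefficients of equal valuation. -/
theorem val_mix {c s a b : ℝ} (h : w c = w s) (hs : 1 < w s) (hab : w a ≠ w b) :
    w (c * a - s * b) = w s * max (w a) (w b) ∧ w (s * a + c * b) = w s * max (w a) (w b) := by
  have hs0 : 0 < w s := zero_lt_one.trans hs
  -- Weights of equal valuation keep the two terms at distinct valuations, so the ultrametric
  -- inequality is an equality.
  have hne : w s * w a ≠ w s * w b := fun e => hab (mul_left_cancel₀ hs0.ne' e)
  have hmax : w s * max (w a) (w b) = max (w s * w a) (w s * w b) :=
    (monotone_mul_left_of_nonneg hs0.le).map_max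
  rw [hmax]
  constructor
  · rw [sub_eq_add_neg, w.map_add_of_distinct_val, Valuation.map_neg, map_mul, map_mul, h]
    rwa [Valuation.map_neg, map_mul, map_mul, h]
  · rw [w.map_add_of_distinct_val, map_mul, map_mul, h]
    rwa [map_mul, map_mul, h]

theorem isZStep_rotZ {θ : ℝ} (h : w (cos θ) = w (sin θ) ∧ 1 < w (sin θ)) :
    IsZStep w (rotZ θ) := by
  intro x hx
  obtain ⟨h0, h1⟩ := val_mix h.1 h.2 hx.1
  have hpos : 0 < max (w (x 0)) (w (x 1)) := by
    rcases lt_or_gt_of_ne hx.1 with h' | h'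
    · exact lt_max_of_lt_right (zero_le.trans_lt h')
    · exact lt_max_of_lt_left (zero_le.trans_lt h')
  have hlt : planarSize w x < w (sin θ) * max (w (x 0)) (w (x 1)) := lt_mul_left hpos h.2
  rw [rotZ_mulVec]
  refine ⟨⟨?_, ?_⟩, ?_⟩
  · simp [h0, h1]
  · simpa [h1] using hx.2.trans_lt hlt
  · simpa [planarSize, h0, h1] using hlt

/-- A quarter turn exchanges the second and third coordinates up to sign, so the first two acquire
different valuations. In the other case the second and third both grow strictly beyond the first,
since in a balanced vector the third is strictly smaller than the second. -/
theorem isXStep_rotX {θ : ℝ}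
    (h : (cos θ = 0 ∧ w (sin θ) = 1) ∨ (w (cos θ) = w (sin θ) ∧ 1 < w (sin θ))) :
    IsXStep w (rotX θ) := by
  refine ⟨fun i => ?_, fun x hx => ?_⟩
  · rw [rotX_mulVec]; fin_cases i <;> simp [e₁]
  rw [rotX_mulVec]
  rcases h with ⟨hc, hs⟩ | h
  · simp only [IsUnbalanced, planarSize, hc]
    simp [Valuation.map_neg, hs, hx.1, hx.2.le, hx.2.ne']
  · obtain ⟨h0, h1⟩ := val_mix h.1 h.2 hx.2.ne'
    rw [max_eq_left hx.2.le] at h0 h1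
    have hlt : w (x 1) < w (sin θ) * w (x 1) := lt_mul_left (zero_le.trans_lt hx.2) h.2
    simp only [IsUnbalanced, planarSize]
    simp [h0, h1, hx.1, hlt.ne, hlt.le]

end PingPong

/-! ### From ping-pong to injectivity on the amalgam. -/

section Faithful

variable {Γ : Type*} [LinearOrderedCommGroupWithZero Γ] {w : Valuation ℝ Γ}

/-- The head of the list acts last, so it determines the region reached. Two adjacent letters
include one z-letter, whose strict growth later letters cannot undo. -/
theorem pingPong_word {F : Bool → Type*} (f : (i : Bool) → F i → SO3)
    (l : List (Σ i, F i)) (hl : l.IsChain fun a b => a.1 ≠ b.1)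
    (hX : ∀ g, ⟨false, g⟩ ∈ l → IsXStep w (f false g))
    (hZ : ∀ g, ⟨true, g⟩ ∈ l → IsZStep w (f true g)) :
    let u := (l.map fun a => f a.1 a.2).prod.1.mulVec e₁
    ((l.head?.map Sigma.fst ≠ some true) → IsUnbalanced w u ∧ 1 ≤ planarSize w u) ∧
    ((l.head?.map Sigma.fst = some true) → IsBalanced w u ∧ 1 < planarSize w u) ∧
    (2 ≤ l.length → 1 < planarSize w u) := by
  induction l with
  | nil =>
    simp [isUnbalanced_e₁, planarSize_e₁]
  | cons a l ih =>
    have ih := ih hl.tail (fun g hg => hX g (List.mem_cons_of_mem _ hg))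
      (fun g hg => hZ g (List.mem_cons_of_mem _ hg))
    dsimp only at ih ⊢
    rw [List.map_cons, List.prod_cons, mulVec_coe_mul]
    generalize hu : (l.map fun a => f a.1 a.2).prod.1.mulVec e₁ = u at ih ⊢
    obtain ⟨i, g⟩ := a
    have hne : ∀ j, i = j → l.head?.map Sigma.fst ≠ some j := by
      rintro j rfl
      cases l with
      | nil => simp
      | cons b l => simpa using (List.isChain_cons_cons.mp hl).1.symm
    cases i with
    | true =>
      obtain ⟨h1, h2⟩ := ih.1 (hne true rfl)
      obtain ⟨h3, h4⟩ := hZ g List.mem_cons_self u h1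
      simp [h3, h2.trans_lt h4]
    | false =>
      have hXg := hX g List.mem_cons_self
      -- The first letter to act meets the vector `e₁`, which is not balanced; the first clause of
      -- `IsXStep` is there for this case.
      cases l with
      | nil =>
        have : u = e₁ := by rw [← hu]; exact Matrix.one_mulVec _
        subst this
        rw [isUnbalanced_congr hXg.1, planarSize_congr hXg.1]
        simp [isUnbalanced_e₁, planarSize_e₁]
      | cons b l =>
        have hb : (b :: l).head?.map Sigma.fst = some true := by
          have := hne false rfl
          simpa using this
        obtain ⟨h1, h2⟩ := ih.2.1 hb
        obtain ⟨h3, h4⟩ := hXg.2 u h1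
        simp [h3, h2.trans_le h4, (h2.trans_le h4).le]

open Monoid in
theorem injective_of_pingPong {K L H : Type} [Group K] [Group L] [Group H]
    {φ : H →* K} {ψ : H →* L} (hφ : Function.Injective φ) (hψ : Function.Injective ψ)
    (f : Amalgam φ ψ →* SO3)
    (hbase : ∀ h, PreservesVal w (f (Amalgam.inl φ ψ (φ h))))
    (hX : ∀ k, k ∉ φ.range → IsXStep w (f (Amalgam.inl φ ψ k)))
    (hZ : ∀ l, l ∉ ψ.range → IsZStep w (f (Amalgam.inr φ ψ l)))
    (hinl : ∀ k, f (Amalgam.inl φ ψ k) = 1 → k = 1) : Function.Injective f := by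
  have hinj : ∀ i, Function.Injective (factorHom φ ψ i) := by
    rintro (_ | _)
    · exact hφ
    · exact hψ
  obtain ⟨d⟩ := PushoutI.NormalWord.transversal_nonempty (factorHom φ ψ) hinj
  classical
  rw [injective_iff_map_eq_one]
  intro x hx
  obtain ⟨n, rfl⟩ := PushoutI.NormalWord.equiv (d := d).symm.surjective x
  change f n.prod = 1 at hx
  change n.prod = 1
  rw [PushoutI.NormalWord.prod] at hx ⊢
  set y := PushoutI.base (factorHom φ ψ) n.head with hy
  have hyl : y = Amalgam.inl φ ψ (φ n.head) :=
    (PushoutI.of_apply_eq_base (factorHom φ ψ) false n.head).symm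
  -- A letter in the amalgamated subgroup would factor both as g · 1 and as 1 · g through the
  -- transversal; uniqueness makes it 1, which a reduced word excludes.
  have hmem : ∀ i g, (⟨i, g⟩ : Σ i, Factor K L i) ∈ n.toList → g ∉ (factorHom φ ψ i).range := by
    rintro i g hg hgr
    refine n.ne_one _ hg ?_
    have hc := (d.compl i).1
    have : ((⟨g, hgr⟩, ⟨1, d.one_mem i⟩) : (factorHom φ ψ i).range × d.set i) =
        (1, ⟨g, n.normalized i g hg⟩) := hc (by simp)
    simpa using congrArg (fun p => (p.2 : Factor K L i)) this.symm
  have hword : PushoutI.ofCoprodI (φ := factorHom φ ψ) n.toWord.prod =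
      (n.toList.map fun a => PushoutI.of (φ := factorHom φ ψ) a.1 a.2).prod := by
    rw [CoprodI.Word.prod, map_list_prod, List.map_map]
    exact congrArg _ (List.map_congr_left fun a _ => PushoutI.ofCoprodI_of a.1 a.2)
  rw [hword] at hx ⊢
  have key := pingPong_word (w := w) (fun i g => f (PushoutI.of (φ := factorHom φ ψ) i g))
    n.toList n.chain_ne (fun g hg => hX g (hmem false g hg)) (fun g hg => hZ g (hmem true g hg))
  -- The whole element fixes `e₁`, and its base part preserves all valuations, so the remaining word
  -- keeps the size 1.
  have hsize : planarSize w ((n.toList.map fun a =>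
      f (PushoutI.of (φ := factorHom φ ψ) a.1 a.2)).prod.1.mulVec e₁) = 1 := by
    have h1 := hbase n.head
    rw [← hyl] at h1
    rw [← planarSize_congr (h1 _), ← mulVec_coe_mul]
    have : f y * (n.toList.map fun a => f (PushoutI.of (φ := factorHom φ ψ) a.1 a.2)).prod = 1 := by
      rw [← hx, map_mul, map_list_prod, List.map_map]
      rfl
    rw [this]
    exact (congrArg _ (Matrix.one_mulVec _)).trans planarSize_e₁
  dsimp only at key
  rw [hsize] at key
  obtain ⟨-, h2, h3⟩ := key
  -- Size 1 leaves only the empty word or a single left letter; the element is then in the left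
  -- factor and `hinl` applies.
  rcases hl : n.toList with _ | ⟨⟨i, g⟩, _ | ⟨b, t⟩⟩
  · rw [hl] at hx
    simp only [List.map_nil, List.prod_nil, mul_one, hyl] at hx ⊢
    rw [hinl _ hx, map_one]
  · cases i with
    | true => exact absurd (h2 (by simp [hl])).2 (lt_irrefl _)
    | false =>
      rw [hl] at hx
      simp only [List.map_cons, List.map_nil, List.prod_cons, List.prod_nil, mul_one, hyl] at hx ⊢
      have e : Amalgam.inl φ ψ (φ n.head) * PushoutI.of (φ := factorHom φ ψ) false g =
          Amalgam.inl φ ψ (φ n.head * (show K from g)) := (map_mul (Amalgam.inl φ ψ) _ _).symm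
      rw [e] at hx ⊢
      rw [hinl _ hx, map_one]
  · exact absurd (h3 (by simp [hl])) (lt_irrefl _)

end Faithful

/-! ### Homomorphisms out of cyclic and dihedral groups. -/

section Homs

variable {M : Type*} [Group M]

/-- The homomorphism from a cyclic group determined by the image of the generator. -/
def cycHom (n : ℕ) (a : M) (h : a ^ n = 1) : Cyc n →* M :=
  AddMonoidHom.toMultiplicativeLeft (ZMod.lift n ⟨zmultiplesHom (Additive M) (Additive.ofMul a), by
    rw [zmultiplesHom_apply, natCast_zsmul, ← ofMul_pow, h, ofMul_one]⟩)

theorem cycHom_intCast (n : ℕ) (a : M) (h : a ^ n = 1) (k : ℤ) :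
    cycHom n a h (Multiplicative.ofAdd (k : ZMod n)) = a ^ k := by
  simp [cycHom, ← ofMul_zpow]

theorem cycHom_gen (n : ℕ) (a : M) (h : a ^ n = 1) : cycHom n a h (Cyc.gen n) = a := by
  simpa [Cyc.gen] using cycHom_intCast n a h 1

theorem cyc_exists_int {n : ℕ} (x : Cyc n) : ∃ k : ℤ, x = Multiplicative.ofAdd (k : ZMod n) := by
  obtain ⟨k, hk⟩ := ZMod.intCast_surjective x.toAdd
  exact ⟨k, by rw [hk, ofAdd_toAdd]⟩

theorem cyc_ofAdd_intCast (n : ℕ) (k : ℤ) :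
    (Multiplicative.ofAdd (k : ZMod n) : Cyc n) = Cyc.gen n ^ k := by
  rw [Cyc.gen, ← ofAdd_zsmul, zsmul_one]

theorem cycHom_mul_comm (n : ℕ) (a b : M) (h : a ^ n = 1) (hb : b * b = 1)
    (hab : b * a * b = a⁻¹) (x : Cyc n) : cycHom n a h x * b = b * cycHom n a h x⁻¹ := by
  obtain ⟨k, rfl⟩ := cyc_exists_int x
  have hb' : b⁻¹ = b := inv_eq_of_mul_eq_one_right hb
  have h1 : b * a ^ k * b = (a ^ k)⁻¹ := by
    have hc : b * a ^ k * b⁻¹ = (b * a * b⁻¹) ^ k := conj_zpow.symm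
    rwa [hb', hab, inv_zpow] at hc
  rw [map_inv, cycHom_intCast, ← h1, mul_assoc, ← mul_assoc b b, hb, one_mul]

/-- The homomorphism from a dihedral group determined by the images of the generators. -/
def dihedralHom (n : ℕ) (a b : M) (h : a ^ n = 1) (hb : b * b = 1) (hab : b * a * b = a⁻¹) :
    DihedralGroup n →* M where
  toFun
    | .r i => cycHom n a h (Multiplicative.ofAdd i)
    | .sr i => b * cycHom n a h (Multiplicative.ofAdd i)
  map_one' := map_one (cycHom n a h)
  map_mul' := by
    have hc := fun i : ZMod n => cycHom_mul_comm n a b h hb hab (Multiplicative.ofAdd i)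
    have hsub : ∀ i j : ZMod n, cycHom n a h (Multiplicative.ofAdd (j - i)) =
        cycHom n a h (Multiplicative.ofAdd i)⁻¹ * cycHom n a h (Multiplicative.ofAdd j) := by
      intro i j
      rw [← map_mul, sub_eq_neg_add, ofAdd_add, ofAdd_neg]
    rintro (i | i) (j | j)
    · exact map_mul (cycHom n a h) _ _
    · change b * _ = _ * (b * _)
      rw [← mul_assoc, hc, hsub, mul_assoc]
    · change b * _ = b * _ * _
      rw [mul_assoc, ← map_mul]; rfl
    · change cycHom n a h (Multiplicative.ofAdd (j - i)) = b * _ * (b * _)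
      rw [mul_assoc, ← mul_assoc _ b, hc, hsub, ← mul_assoc, ← mul_assoc, hb, one_mul]

variable {n : ℕ} {a b : M} {h : a ^ n = 1} {hb : b * b = 1} {hab : b * a * b = a⁻¹}

theorem dihedralHom_r (k : ℤ) : dihedralHom n a b h hb hab (.r (k : ZMod n)) = a ^ k :=
  cycHom_intCast n a h k

theorem dihedralHom_sr (k : ℤ) : dihedralHom n a b h hb hab (.sr (k : ZMod n)) = b * a ^ k :=
  congrArg (b * ·) (cycHom_intCast n a h k)

theorem dihedralHom_rho : dihedralHom n a b h hb hab (rho n) = a := by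
  simpa [rho] using dihedralHom_r (h := h) (hb := hb) (hab := hab) 1

theorem dihedralHom_tau : dihedralHom n a b h hb hab (tau n) = b := by
  simpa [tau] using dihedralHom_sr (h := h) (hb := hb) (hab := hab) 0

theorem dihedral_r_intCast (n : ℕ) (k : ℤ) :
    (.r (k : ZMod n) : DihedralGroup n) = rho n ^ k := (DihedralGroup.r_one_zpow k).symm

theorem dihedral_sr_intCast (n : ℕ) (k : ℤ) :
    (.sr (k : ZMod n) : DihedralGroup n) = tau n * rho n ^ k := by
  rw [← dihedral_r_intCast, tau, DihedralGroup.sr_mul_r, zero_add]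

theorem dihedral_exists_int (x : DihedralGroup n) :
    ∃ k : ℤ, x = rho n ^ k ∨ x = tau n * rho n ^ k := by
  rcases x with i | i <;> obtain ⟨k, rfl⟩ := ZMod.intCast_surjective i
  · exact ⟨k, .inl (dihedral_r_intCast n k)⟩
  · exact ⟨k, .inr (dihedral_sr_intCast n k)⟩

theorem tau_mul_self (n : ℕ) : tau n * tau n = 1 := DihedralGroup.sr_mul_self 0

theorem tau_rho_tau (n : ℕ) : tau n * rho n * tau n = (rho n)⁻¹ := by
  simp [tau, rho]

theorem rho_zpow_eq_one_iff (k : ℤ) : rho n ^ k = 1 ↔ (n : ℤ) ∣ k := by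
  rw [rho, DihedralGroup.r_one_zpow, DihedralGroup.one_def, DihedralGroup.r.injEq,
    ZMod.intCast_zmod_eq_zero_iff_dvd]

theorem tau_mul_rho_zpow_ne_one (k : ℤ) : tau n * rho n ^ k ≠ 1 := by
  rw [← dihedral_sr_intCast, DihedralGroup.one_def]
  exact fun h => by cases h

theorem gen_zpow_eq_one_iff (k : ℤ) : Cyc.gen n ^ k = 1 ↔ (n : ℤ) ∣ k := by
  rw [← cyc_ofAdd_intCast, ofAdd_eq_one, ZMod.intCast_zmod_eq_zero_iff_dvd]

theorem cyc_two_cases (x : Cyc 2) : x = 1 ∨ x = Cyc.gen 2 := by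
  revert x; decide

theorem dihedral_two_cases (x : DihedralGroup 2) :
    x = 1 ∨ x = rho 2 ∨ x = tau 2 ∨ x = tau 2 * rho 2 := by
  revert x; decide

end Homs

/-! ### Relations among the rotations, and which powers are ping-pong steps. -/

section Rotations

theorem SO3_ext {g h : SO3} (H : ∀ x, g.1.mulVec x = h.1.mulVec x) : g = h :=
  Subtype.ext (Matrix.mulVec_injective (funext H))

theorem rotX_add (a b : ℝ) : rotX (a + b) = rotX a * rotX b := SO3_ext fun x => by
  rw [mulVec_coe_mul, rotX_mulVec, rotX_mulVec, rotX_mulVec, cos_add, sin_add]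
  ext i; fin_cases i <;> simp <;> ring

theorem rotZ_add (a b : ℝ) : rotZ (a + b) = rotZ a * rotZ b := SO3_ext fun x => by
  rw [mulVec_coe_mul, rotZ_mulVec, rotZ_mulVec, rotZ_mulVec, cos_add, sin_add]
  ext i; fin_cases i <;> simp <;> ring

theorem rotX_zero : rotX 0 = 1 := by
  have := rotX_add 0 0; rw [add_zero] at this; exact left_eq_mul.mp this

theorem rotZ_zero : rotZ 0 = 1 := by
  have := rotZ_add 0 0; rw [add_zero] at this; exact left_eq_mul.mp this

/-- Rotations about the `x`-axis as a homomorphism. -/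
noncomputable def rotXHom : Multiplicative ℝ →* SO3 where
  toFun θ := rotX θ.toAdd
  map_one' := rotX_zero
  map_mul' a b := rotX_add a.toAdd b.toAdd

/-- Rotations about the `z`-axis as a homomorphism. -/
noncomputable def rotZHom : Multiplicative ℝ →* SO3 where
  toFun θ := rotZ θ.toAdd
  map_one' := rotZ_zero
  map_mul' a b := rotZ_add a.toAdd b.toAdd

theorem rotX_zpow (θ : ℝ) (k : ℤ) : rotX θ ^ k = rotX (k * θ) := by
  rw [← zsmul_eq_mul]; exact (map_zpow rotXHom (Multiplicative.ofAdd θ) k).symm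

theorem rotZ_zpow (θ : ℝ) (k : ℤ) : rotZ θ ^ k = rotZ (k * θ) := by
  rw [← zsmul_eq_mul]; exact (map_zpow rotZHom (Multiplicative.ofAdd θ) k).symm

theorem rotX_inv (θ : ℝ) : (rotX θ)⁻¹ = rotX (-θ) := by
  simpa using rotX_zpow θ (-1)

theorem rotZ_inv (θ : ℝ) : (rotZ θ)⁻¹ = rotZ (-θ) := by
  simpa using rotZ_zpow θ (-1)

theorem rotX_two_pi : rotX (2 * π) = 1 := SO3_ext fun x => by
  rw [rotX_mulVec, show (1 : SO3).1 = 1 from rfl, Matrix.one_mulVec]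
  ext i; fin_cases i <;> simp

theorem rotZ_two_pi : rotZ (2 * π) = 1 := SO3_ext fun x => by
  rw [rotZ_mulVec, show (1 : SO3).1 = 1 from rfl, Matrix.one_mulVec]
  ext i; fin_cases i <;> simp

theorem rotX_pi_mul_self : rotX π * rotX π = 1 := by
  rw [← rotX_add, ← two_mul, rotX_two_pi]

theorem rotZ_pi_mul_self : rotZ π * rotZ π = 1 := by
  rw [← rotZ_add, ← two_mul, rotZ_two_pi]

theorem rotX_pi_conj (θ : ℝ) : rotX π * rotZ θ * rotX π = (rotZ θ)⁻¹ := by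
  rw [rotZ_inv]
  refine SO3_ext fun x => ?_
  rw [mulVec_coe_mul, mulVec_coe_mul, rotX_mulVec, rotX_mulVec, rotZ_mulVec, rotZ_mulVec]
  ext i; fin_cases i <;> simp; ring

theorem rotZ_pi_conj (θ : ℝ) : rotZ π * rotX θ * rotZ π = (rotX θ)⁻¹ := by
  rw [rotX_inv]
  refine SO3_ext fun x => ?_
  rw [mulVec_coe_mul, mulVec_coe_mul, rotZ_mulVec, rotZ_mulVec, rotX_mulVec, rotX_mulVec]
  ext i; fin_cases i <;> simp; ring

theorem rotA_pow_self {p : ℕ} (hp : p ≠ 0) : rotA p ^ p = 1 := by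
  have hp' : (p : ℝ) ≠ 0 := by exact_mod_cast hp
  rw [← zpow_natCast, rotA, rotX_zpow, ← rotX_two_pi]
  congr 1; push_cast; field_simp

theorem rotB_pow_self {q : ℕ} (hq : q ≠ 0) : rotB q ^ q = 1 := by
  have hq' : (q : ℝ) ≠ 0 := by exact_mod_cast hq
  rw [← zpow_natCast, rotB, rotZ_zpow, ← rotZ_two_pi]
  congr 1; push_cast; field_simp

theorem rotA_pow_half {p : ℕ} (hp : p ≠ 0) (he : Even p) : rotA p ^ (p / 2) = rotX π := by
  obtain ⟨m, rfl⟩ := he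
  have hp' : (m : ℝ) ≠ 0 := by exact_mod_cast (by omega : m ≠ 0)
  rw [show (m + m) / 2 = m by omega, ← zpow_natCast, rotA, rotX_zpow]
  congr 1; push_cast; field_simp; ring

theorem rotB_pow_half {q : ℕ} (hq : q ≠ 0) (he : Even q) : rotB q ^ (q / 2) = rotZ π := by
  obtain ⟨m, rfl⟩ := he
  have hq' : (m : ℝ) ≠ 0 := by exact_mod_cast (by omega : m ≠ 0)
  rw [show (m + m) / 2 = m by omega, ← zpow_natCast, rotB, rotZ_zpow]
  congr 1; push_cast; field_simp; ring

theorem dvd_of_rotA_zpow_eq_one {p : ℕ} (hp : p ≠ 0) {k : ℤ} (h : rotA p ^ k = 1) :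
    (p : ℤ) ∣ k := by
  rw [rotA, rotX_zpow] at h
  have h1 := congrArg (fun g : SO3 => g.1.mulVec ![0, 1, 0] 1) h
  have h2 : cos (k * (2 * π / p)) = 1 := by
    simpa [rotX_mulVec, Matrix.one_mulVec] using h1
  rw [cos_eq_one_iff] at h2
  obtain ⟨n, hn⟩ := h2
  have hp' : (p : ℝ) ≠ 0 := by exact_mod_cast hp
  field_simp at hn
  exact ⟨n, by exact_mod_cast hn.symm.trans (mul_comm _ _)⟩

theorem rotZ_pi_mul_rotA_zpow_ne_one (p : ℕ) (k : ℤ) : rotZ π * rotA p ^ k ≠ 1 := by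
  intro h
  rw [rotA, rotX_zpow] at h
  have h1 := congrArg (fun g : SO3 => g.1.mulVec ![1, 0, 0] 0) h
  simp only [mulVec_coe_mul, rotZ_mulVec, rotX_mulVec] at h1
  have h2 : (-1 : ℝ) = 1 := by simpa using h1
  norm_num at h2

variable {Γ : Type*} [LinearOrderedCommGroupWithZero Γ] {v : Valuation ℂ Γ}

theorem isXStep_rotA_zpow (hv : v 2 < 1) {p : ℕ} (hp : p ≠ 0) {k : ℤ} (hk : ¬ (p : ℤ) ∣ k * 2) :
    IsXStep (v.comap Complex.ofRealHom) (rotA p ^ k) := by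
  rw [rotA, rotX_zpow]
  have hp' : (p : ℤ) ≠ 0 := by exact_mod_cast hp
  exact isXStep_rotX (val_cos_sin_of_pow_eq_one hv hp
    (exp_angle_pow hp' (dvd_mul_left _ _) (by push_cast; rfl))
    fun h => hk (by simpa using dvd_of_exp_angle_pow hp' (by push_cast; rfl) h))

/-- Both cases of the theorem are covered, with m = q for q odd and m = s for q = 2s: the order of
exp(2iθ) divides the odd number m, so quarter turns cannot occur. -/
theorem isZStep_rotB_zpow (hv : v 2 < 1) {q m : ℕ} (hm : Odd m) (hq : q ≠ 0) (hqm : q ∣ 2 * m)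
    {k : ℤ} (hk : ¬ (q : ℤ) ∣ k * 2) :
    IsZStep (v.comap Complex.ofRealHom) (rotB q ^ k) := by
  rw [rotB, rotZ_zpow]
  have hq' : (q : ℤ) ≠ 0 := by exact_mod_cast hq
  refine isZStep_rotZ (val_cos_sin_of_odd hv hm ?_
    fun h => hk (by simpa using dvd_of_exp_angle_pow hq' (by push_cast; rfl) h))
  rw [← pow_mul]
  exact exp_angle_pow hq' ((Int.natCast_dvd_natCast.mpr hqm).mul_left k) (by push_cast; rfl)

end Rotations

/-! ### Identifying the amalgam with G(p,q). -/

section Assembly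

theorem rotA_mem_G (p q : ℕ) : rotA p ∈ G p q := Subgroup.subset_closure (by simp)

theorem rotB_mem_G (p q : ℕ) : rotB q ∈ G p q := Subgroup.subset_closure (by simp)

variable {K L H : Type} [Group K] [Group L] [Group H] {φ : H →* K} {ψ : H →* L}

/-- The homomorphism out of an amalgamated product given by compatible homomorphisms on the
factors. -/
def amalgamLift {M : Type*} [Group M] (f : K →* M) (g : L →* M) (h : f.comp φ = g.comp ψ) :
    Amalgam φ ψ →* M :=
  Monoid.PushoutI.lift (fun | false => f | true => g) (f.comp φ) (by
    rintro (_ | _)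
    · rfl
    · exact h.symm)

theorem amalgamLift_inl {M : Type*} [Group M] (f : K →* M) (g : L →* M)
    (h : f.comp φ = g.comp ψ) (k : K) : amalgamLift f g h (Amalgam.inl φ ψ k) = f k :=
  Monoid.PushoutI.lift_of _ _ _ _

theorem amalgamLift_inr {M : Type*} [Group M] (f : K →* M) (g : L →* M)
    (h : f.comp φ = g.comp ψ) (l : L) : amalgamLift f g h (Amalgam.inr φ ψ l) = g l :=
  Monoid.PushoutI.lift_of _ _ _ _

theorem amalgamLift_range {M : Type*} [Group M] {f : K →* M} {g : L →* M}
    (h : f.comp φ = g.comp ψ) : (amalgamLift f g h).range = f.range ⊔ g.range := by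
  apply le_antisymm
  · rintro _ ⟨x, rfl⟩
    induction x using Monoid.PushoutI.induction_on with
    | of i y =>
      cases i with
      | false =>
        exact le_sup_left (a := f.range) ⟨y, (amalgamLift_inl f g h y).symm⟩
      | true => exact le_sup_right (a := f.range) ⟨y, (amalgamLift_inr f g h y).symm⟩
    | base y =>
      rw [← Monoid.PushoutI.of_apply_eq_base (factorHom φ ψ) false y]
      exact le_sup_left (a := f.range) ⟨φ y, (amalgamLift_inl f g h (φ y)).symm⟩
    | mul x y hx hy => rw [map_mul]; exact mul_mem hx hy
  · refine sup_le ?_ ?_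
    · rintro _ ⟨k, rfl⟩
      exact ⟨Amalgam.inl φ ψ k, amalgamLift_inl f g h k⟩
    · rintro _ ⟨k, rfl⟩
      exact ⟨Amalgam.inr φ ψ k, amalgamLift_inr f g h k⟩

/-- A faithful pair of compatible representations whose images generate `G p q` identifies the
amalgamated product with `G p q`. -/
theorem exists_mulEquiv_of_pingPong {Γ : Type*} [LinearOrderedCommGroupWithZero Γ]
    {w : Valuation ℝ Γ} {p q : ℕ} (hφ : Function.Injective φ) (hψ : Function.Injective ψ)
    (f : K →* SO3) (g : L →* SO3) (h : f.comp φ = g.comp ψ)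
    (hbase : ∀ h, PreservesVal w (f (φ h)))
    (hX : ∀ k, k ∉ φ.range → IsXStep w (f k))
    (hZ : ∀ l, l ∉ ψ.range → IsZStep w (g l))
    (hinl : ∀ k, f k = 1 → k = 1)
    (hf : f.range ≤ G p q) (hg : g.range ≤ G p q)
    {a : K} (ha : f a = rotA p) {b : L} (hb : g b = rotB q) :
    ∃ e : Amalgam φ ψ ≃* G p q,
      (e (Amalgam.inl φ ψ a) : SO3) = rotA p ∧ (e (Amalgam.inr φ ψ b) : SO3) = rotB q := by
  have hinj : Function.Injective (amalgamLift f g h) :=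
    injective_of_pingPong (w := w) hφ hψ _
      (fun x => by rw [amalgamLift_inl]; exact hbase x)
      (fun x hx => by rw [amalgamLift_inl]; exact hX x hx)
      (fun x hx => by rw [amalgamLift_inr]; exact hZ x hx)
      (fun x hx => by rw [amalgamLift_inl] at hx; exact hinl x hx)
  have hrange : (amalgamLift f g h).range = G p q := by
    rw [amalgamLift_range]
    refine le_antisymm (sup_le hf hg) ?_
    rw [G, Subgroup.closure_le]
    rintro _ (rfl | rfl)
    · exact le_sup_left (a := f.range) ⟨a, ha⟩
    · exact le_sup_right (a := f.range) ⟨b, hb⟩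
  refine ⟨(MonoidHom.ofInjective hinj).trans (MulEquiv.subgroupCongr hrange), ?_, ?_⟩
  · exact (amalgamLift_inl f g h a).trans ha
  · exact (amalgamLift_inr f g h b).trans hb

/-- If `p ∣ 2k` with `p` even, then `a ^ k` is a power of `a ^ (p/2)`. -/
theorem zpow_mem_of_dvd_mul_two {M : Type*} [Group M] {S : Subgroup M} {a : M} {p : ℕ}
    (he : Even p) (ha : a ^ (p / 2) ∈ S) {k : ℤ} (hk : (p : ℤ) ∣ k * 2) : a ^ k ∈ S := by
  obtain ⟨c, hc⟩ := hk
  obtain ⟨m, rfl⟩ := he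
  have : k = m * c := by push_cast at hc; linarith
  rw [show (m + m) / 2 = m by omega] at ha
  rw [this, zpow_mul, zpow_natCast]
  exact zpow_mem ha c

end Assembly

/-! ### The two cases of the theorem. -/

open Function

theorem amalgam_cyclic_dihedral (p q : ℕ) (hp : 4 ≤ p) (hp_even : Even p) (hq : 3 ≤ q)
    (hq_odd : Odd q) :
    ∃ (φ : Cyc 2 →* Cyc p) (ψ : Cyc 2 →* DihedralGroup q),
      Function.Injective φ ∧ Function.Injective ψ ∧
      φ (Cyc.gen 2) = Cyc.gen p ^ (p / 2) ∧
      ψ (Cyc.gen 2) = tau q ∧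
      ∃ e : Amalgam φ ψ ≃* G p q,
        (e (Amalgam.inl φ ψ (Cyc.gen p)) : SO3) = rotA p ∧
        (e (Amalgam.inr φ ψ (rho q)) : SO3) = rotB q := by
  have hp0 : p ≠ 0 := by omega
  have hq0 : q ≠ 0 := by omega
  obtain ⟨Γ, _, v, hv⟩ := exists_valuation_two_lt_one
  have hgen : (Cyc.gen p ^ (p / 2)) ^ 2 = 1 := by
    rw [← pow_mul, Nat.div_mul_cancel hp_even.two_dvd, ← zpow_natCast, gen_zpow_eq_one_iff]
  have hhalf : Cyc.gen p ^ (p / 2) ≠ 1 := by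
    rw [← zpow_natCast, Ne, gen_zpow_eq_one_iff, Int.natCast_dvd_natCast]
    exact Nat.not_dvd_of_pos_of_lt (by omega) (by omega)
  let φ : Cyc 2 →* Cyc p := cycHom 2 (Cyc.gen p ^ (p / 2)) hgen
  let ψ : Cyc 2 →* DihedralGroup q := cycHom 2 (tau q) (by rw [sq, tau_mul_self])
  have hφg : φ (Cyc.gen 2) = Cyc.gen p ^ (p / 2) := cycHom_gen _ _ _
  have hψg : ψ (Cyc.gen 2) = tau q := cycHom_gen _ _ _
  have hφ : Injective φ := by
    rw [injective_iff_map_eq_one]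
    intro x hx
    rcases cyc_two_cases x with rfl | rfl
    · rfl
    · exact absurd (hφg.symm.trans hx) hhalf
  have hψ : Injective ψ := by
    rw [injective_iff_map_eq_one]
    intro x hx
    rcases cyc_two_cases x with rfl | rfl
    · rfl
    · exact absurd (hψg.symm.trans hx) (by simpa using tau_mul_rho_zpow_ne_one (n := q) 0)
  let f : Cyc p →* SO3 := cycHom p (rotA p) (rotA_pow_self hp0)
  let g : DihedralGroup q →* SO3 := dihedralHom q (rotB q) (rotX π) (rotB_pow_self hq0)
    rotX_pi_mul_self (rotX_pi_conj _)
  have hf : f (Cyc.gen p) = rotA p := cycHom_gen _ _ _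
  have hg : g (rho q) = rotB q := dihedralHom_rho
  have hgt : g (tau q) = rotX π := dihedralHom_tau
  have hfφ : f (φ (Cyc.gen 2)) = rotX π := by rw [hφg, map_pow, hf, rotA_pow_half hp0 hp_even]
  refine ⟨φ, ψ, hφ, hψ, hφg, hψg,
    exists_mulEquiv_of_pingPong (w := v.comap Complex.ofRealHom) hφ hψ f g ?_ ?_ ?_ ?_ ?_ ?_ ?_
      hf hg⟩
  · refine MonoidHom.ext fun x => ?_
    rcases cyc_two_cases x with rfl | rfl
    · simp
    · simp only [MonoidHom.comp_apply]
      rw [hfφ, hψg, hgt]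
  · intro x
    rcases cyc_two_cases x with rfl | rfl
    · rw [map_one, map_one]; exact preservesVal_one
    · rw [hfφ]; exact preservesVal_rotX_pi
  · intro x hx
    obtain ⟨k, rfl⟩ := cyc_exists_int x
    rw [cyc_ofAdd_intCast] at hx ⊢
    rw [map_zpow, hf]
    exact isXStep_rotA_zpow hv hp0 fun hk =>
      hx (zpow_mem_of_dvd_mul_two hp_even (MonoidHom.mem_range.mpr ⟨_, hφg⟩) hk)
  · intro x hx
    have hk : ∀ k : ℤ, rho q ^ k ∉ ψ.range →
        IsZStep (v.comap Complex.ofRealHom) (g (rho q ^ k)) := by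
      intro k hk
      rw [map_zpow, hg]
      refine isZStep_rotB_zpow hv hq_odd hq0 (dvd_mul_left q 2) fun hd => hk ?_
      -- As q is odd, the factor 2 cancels, and the excluded power is the identity.
      have : (q : ℤ) ∣ k := IsCoprime.dvd_of_dvd_mul_right
        (by rw [← Nat.cast_two, Nat.isCoprime_iff_coprime]; exact hq_odd.coprime_two_right) hd
      rw [(rho_zpow_eq_one_iff k).mpr this]
      exact one_mem _
    obtain ⟨k, rfl | rfl⟩ := dihedral_exists_int x
    · exact hk k hx
    · rw [map_mul, hgt]
      -- A reflection is an amalgamated half turn times a rotation, and the half turn changes no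
      -- valuation.
      exact preservesVal_rotX_pi.mul_isZStep (hk k fun hr => hx (mul_mem ⟨_, hψg⟩ hr))
  · intro x hx
    obtain ⟨k, rfl⟩ := cyc_exists_int x
    rw [cyc_ofAdd_intCast] at hx ⊢
    rw [map_zpow, hf] at hx
    exact (gen_zpow_eq_one_iff k).mpr (dvd_of_rotA_zpow_eq_one hp0 hx)
  · rintro _ ⟨x, rfl⟩
    obtain ⟨k, rfl⟩ := cyc_exists_int x
    rw [cyc_ofAdd_intCast, map_zpow, hf]
    exact zpow_mem (rotA_mem_G p q) k
  · rintro _ ⟨x, rfl⟩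
    obtain ⟨k, rfl | rfl⟩ := dihedral_exists_int x
    · rw [map_zpow, hg]
      exact zpow_mem (rotB_mem_G p q) k
    · rw [map_mul, map_zpow, hg, hgt, ← rotA_pow_half hp0 hp_even]
      exact mul_mem (pow_mem (rotA_mem_G p q) _) (zpow_mem (rotB_mem_G p q) k)

theorem amalgam_dihedral_dihedral (p q : ℕ) (hp : 4 ≤ p) (hp_even : Even p) (s : ℕ)
    (hqs : q = 2 * s) (hs : 3 ≤ s) (hs_odd : Odd s) :
    ∃ (φ : DihedralGroup 2 →* DihedralGroup p) (ψ : DihedralGroup 2 →* DihedralGroup q),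
      Function.Injective φ ∧ Function.Injective ψ ∧
      φ (tau 2) = tau p ∧ ψ (tau 2) = rho q ^ (q / 2) ∧
      φ (rho 2) = rho p ^ (p / 2) ∧ ψ (rho 2) = tau q ∧
      ∃ e : Amalgam φ ψ ≃* G p q,
        (e (Amalgam.inl φ ψ (rho p)) : SO3) = rotA p ∧
        (e (Amalgam.inr φ ψ (rho q)) : SO3) = rotB q := by
  have hp0 : p ≠ 0 := by omega
  have hq0 : q ≠ 0 := by omega
  have hq_even : Even q := ⟨s, by omega⟩
  obtain ⟨Γ, _, v, hv⟩ := exists_valuation_two_lt_one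
  have hsq : ∀ {n : ℕ}, Even n → (rho n ^ (n / 2)) ^ 2 = 1 := fun {n} hn => by
    rw [← pow_mul, Nat.div_mul_cancel hn.two_dvd, ← zpow_natCast, rho_zpow_eq_one_iff]
  have hhalf : ∀ {n : ℕ}, 4 ≤ n → rho n ^ (n / 2) ≠ 1 := fun {n} hn => by
    rw [← zpow_natCast, Ne, rho_zpow_eq_one_iff, Int.natCast_dvd_natCast]
    exact Nat.not_dvd_of_pos_of_lt (by omega) (by omega)
  have hconj : ∀ {n : ℕ}, tau n * rho n ^ (n / 2) * tau n = (rho n ^ (n / 2))⁻¹ := fun {n} => by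
    have ht : (tau n)⁻¹ = tau n := inv_eq_of_mul_eq_one_right (tau_mul_self n)
    rw [← inv_pow, ← tau_rho_tau]
    -- The right-hand factor of each conjugation becomes an inverse, the form in which conjugation
    -- commutes with powers.
    nth_rw 2 4 [← ht]
    exact (conj_pow).symm
  let φ : DihedralGroup 2 →* DihedralGroup p :=
    dihedralHom 2 (rho p ^ (p / 2)) (tau p) (hsq hp_even) (tau_mul_self p) hconj
  let ψ : DihedralGroup 2 →* DihedralGroup q :=
    dihedralHom 2 (tau q) (rho q ^ (q / 2)) (by rw [sq, tau_mul_self])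
      -- Rotation and reflection exchange roles under `ψ`; the required relation holds because the
      -- two involutions commute.
      (by rw [← sq, hsq hq_even]) (by
        have h1 := hconj (n := q)
        have h2 := tau_mul_self q
        have h3 := hsq hq_even
        rw [sq] at h3
        rw [inv_eq_of_mul_eq_one_right h3] at h1
        rw [inv_eq_of_mul_eq_one_right h2]
        calc _ = tau q * (tau q * rho q ^ (q / 2) * tau q) * rho q ^ (q / 2) := by
              simp only [← mul_assoc, h2, one_mul]
          _ = tau q := by rw [h1, mul_assoc, h3, mul_one])
  have hφr : φ (rho 2) = rho p ^ (p / 2) := dihedralHom_rho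
  have hφt : φ (tau 2) = tau p := dihedralHom_tau
  have hψr : ψ (rho 2) = tau q := dihedralHom_rho
  have hψt : ψ (tau 2) = rho q ^ (q / 2) := dihedralHom_tau
  have htau : ∀ n : ℕ, tau n ≠ 1 := fun n => by simpa using tau_mul_rho_zpow_ne_one (n := n) 0
  have hφ : Injective φ := by
    rw [injective_iff_map_eq_one]
    intro x hx
    rcases dihedral_two_cases x with rfl | rfl | rfl | rfl
    · rfl
    · exact absurd (hφr.symm.trans hx) (hhalf hp)
    · exact absurd (hφt.symm.trans hx) (htau p)
    · rw [map_mul, hφr, hφt, ← zpow_natCast] at hx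
      exact absurd hx (tau_mul_rho_zpow_ne_one _)
  have hψ : Injective ψ := by
    rw [injective_iff_map_eq_one]
    intro x hx
    rcases dihedral_two_cases x with rfl | rfl | rfl | rfl
    · rfl
    · exact absurd (hψr.symm.trans hx) (htau q)
    · exact absurd (hψt.symm.trans hx) (hhalf (by omega))
    · rw [map_mul, hψr, hψt, mul_eq_one_comm, ← zpow_natCast] at hx
      exact absurd hx (tau_mul_rho_zpow_ne_one _)
  let f : DihedralGroup p →* SO3 := dihedralHom p (rotA p) (rotZ π) (rotA_pow_self hp0)
    rotZ_pi_mul_self (rotZ_pi_conj _)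
  let g : DihedralGroup q →* SO3 := dihedralHom q (rotB q) (rotX π) (rotB_pow_self hq0)
    rotX_pi_mul_self (rotX_pi_conj _)
  have hf : f (rho p) = rotA p := dihedralHom_rho
  have hft : f (tau p) = rotZ π := dihedralHom_tau
  have hg : g (rho q) = rotB q := dihedralHom_rho
  have hgt : g (tau q) = rotX π := dihedralHom_tau
  have hfφr : f (φ (rho 2)) = rotX π := by rw [hφr, map_pow, hf, rotA_pow_half hp0 hp_even]
  have hfφt : f (φ (tau 2)) = rotZ π := by rw [hφt, hft]
  have hgψr : g (ψ (rho 2)) = rotX π := by rw [hψr, hgt]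
  have hgψt : g (ψ (tau 2)) = rotZ π := by rw [hψt, map_pow, hg, rotB_pow_half hq0 hq_even]
  refine ⟨φ, ψ, hφ, hψ, hφt, hψt, hφr, hψr,
    exists_mulEquiv_of_pingPong (w := v.comap Complex.ofRealHom) hφ hψ f g ?_ ?_ ?_ ?_ ?_ ?_ ?_
      hf hg⟩
  · refine MonoidHom.ext fun x => ?_
    simp only [MonoidHom.comp_apply]
    rcases dihedral_two_cases x with rfl | rfl | rfl | rfl
    · simp only [map_one]
    · rw [hfφr, hgψr]
    · rw [hfφt, hgψt]
    · simp only [map_mul, hfφr, hgψr, hfφt, hgψt]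
  · intro x
    rcases dihedral_two_cases x with rfl | rfl | rfl | rfl
    · rw [map_one, map_one]; exact preservesVal_one
    · rw [hfφr]; exact preservesVal_rotX_pi
    · rw [hfφt]; exact preservesVal_rotZ_pi
    · rw [map_mul, map_mul, hfφr, hfφt]; exact preservesVal_rotZ_pi.mul preservesVal_rotX_pi
  · intro x hx
    have hk : ∀ k : ℤ, rho p ^ k ∉ φ.range →
        IsXStep (v.comap Complex.ofRealHom) (f (rho p ^ k)) := by
      intro k hk
      rw [map_zpow, hf]
      exact isXStep_rotA_zpow hv hp0 fun hd =>
        hk (zpow_mem_of_dvd_mul_two hp_even (MonoidHom.mem_range.mpr ⟨_, hφr⟩) hd)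
    obtain ⟨k, rfl | rfl⟩ := dihedral_exists_int x
    · exact hk k hx
    · rw [map_mul, hft]
      exact preservesVal_rotZ_pi.mul_isXStep (hk k fun hr => hx (mul_mem ⟨_, hφt⟩ hr))
  · intro x hx
    have hk : ∀ k : ℤ, rho q ^ k ∉ ψ.range →
        IsZStep (v.comap Complex.ofRealHom) (g (rho q ^ k)) := by
      intro k hk
      rw [map_zpow, hg]
      exact isZStep_rotB_zpow hv hs_odd hq0 hqs.dvd fun hd =>
        hk (zpow_mem_of_dvd_mul_two hq_even (MonoidHom.mem_range.mpr ⟨_, hψt⟩) hd)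
    obtain ⟨k, rfl | rfl⟩ := dihedral_exists_int x
    · exact hk k hx
    · rw [map_mul, hgt]
      exact preservesVal_rotX_pi.mul_isZStep (hk k fun hr => hx (mul_mem ⟨_, hψr⟩ hr))
  · intro x hx
    obtain ⟨k, rfl | rfl⟩ := dihedral_exists_int x
    · rw [map_zpow, hf] at hx
      exact (rho_zpow_eq_one_iff k).mpr (dvd_of_rotA_zpow_eq_one hp0 hx)
    · rw [map_mul, map_zpow, hf, hft] at hx
      exact absurd hx (rotZ_pi_mul_rotA_zpow_ne_one p k)
  · rintro _ ⟨x, rfl⟩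
    obtain ⟨k, rfl | rfl⟩ := dihedral_exists_int x
    · rw [map_zpow, hf]
      exact zpow_mem (rotA_mem_G p q) k
    -- The left factor's reflection acts as the half turn B^(q/2), so its image stays inside G(p,q).
    · rw [map_mul, map_zpow, hf, hft, ← rotB_pow_half hq0 hq_even]
      exact mul_mem (pow_mem (rotB_mem_G p q) _) (zpow_mem (rotA_mem_G p q) k)
  · rintro _ ⟨x, rfl⟩
    obtain ⟨k, rfl | rfl⟩ := dihedral_exists_int x
    · rw [map_zpow, hg]
      exact zpow_mem (rotB_mem_G p q) k
    · rw [map_mul, map_zpow, hg, hgt, ← rotA_pow_half hp0 hp_even]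
      exact mul_mem (pow_mem (rotA_mem_G p q) _) (zpow_mem (rotB_mem_G p q) k)

end RotationGroup

open RotationGroup in
theorem corollary2 (p q : ℕ) (hp : 4 ≤ p) (hp_even : Even p) :
    (3 ≤ q → Odd q →
      ∃ (φ : Cyc 2 →* Cyc p) (ψ : Cyc 2 →* DihedralGroup q),
        Function.Injective φ ∧ Function.Injective ψ ∧
        φ (Cyc.gen 2) = Cyc.gen p ^ (p / 2) ∧
        ψ (Cyc.gen 2) = tau q ∧
        ∃ e : Amalgam φ ψ ≃* G p q,
          (e (Amalgam.inl φ ψ (Cyc.gen p)) : SO3) = rotA p ∧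
          (e (Amalgam.inr φ ψ (rho q)) : SO3) = rotB q) ∧
    (∀ s : ℕ, q = 2 * s → 3 ≤ s → Odd s →
      ∃ (φ : DihedralGroup 2 →* DihedralGroup p) (ψ : DihedralGroup 2 →* DihedralGroup q),
        Function.Injective φ ∧ Function.Injective ψ ∧
        φ (tau 2) = tau p ∧ ψ (tau 2) = rho q ^ (q / 2) ∧
        φ (rho 2) = rho p ^ (p / 2) ∧ ψ (rho 2) = tau q ∧
        ∃ e : Amalgam φ ψ ≃* G p q,
          (e (Amalgam.inl φ ψ (rho p)) : SO3) = rotA p ∧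
          (e (Amalgam.inr φ ψ (rho q)) : SO3) = rotB q) :=
  ⟨amalgam_cyclic_dihedral p q hp hp_even, amalgam_dihedral_dihedral p q hp hp_even⟩
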